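/- **Theorem 2.** Let $p$ be a prime. A $p$-ary box is a conditional distribution $P(a,b\mid x,y)$ with $x,y,a,b\in\mathbb Z_p$ ($x,a$ on Alice's side, $y,b$ on Bob's side) that is no-signalling: $\sum_b P(a,b\mid x,y)$ does not depend on $y$ and $\sum_a P(a,b\mid x,y)$ does not depend on $x$. Consider a world, given by the no-signalling boxes (with finite output alphabets) that are available in it in any number of independent copies, in addition to shared randomness. Suppose that information causality holds in this world: for all $N,m\ge 0$, if Alice receives uniformly random independent digits $x_0,\dots,x_{N-1}\in\mathbb Z_p$ and sends $m$ digits of $\mathbb Z_p$ to Bob, and Bob, given an index $y\in\{0,\dots,N-1\}$, outputs a guess $b\in\mathbb Z_p$ of $x_y$, then every protocol that uses shared randomness and finitely many available boxes satisfies $$\sum_{i=0}^{N-1} I(x_i:b\mid y=i)\le m\log p,$$ where $I(x_i:b\mid y=i)$ is the Shannon mutual information of $x_i$ and $b$ when Bob receives $y=i$. Then every $p$-ary box $P$ available in this world satisfies, for all integers $1\le N\le p$ and all $c\in\mathbb Z_p$, $$\frac1p\sum_{k=0}^{p-1}\omega_p^{ck}\Bigl(\sum_{j=0}^{p-1}\mu_j\,\omega_p^{jk}\Bigr)^{N-1}\le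 h_p^{-1}\Bigl(\frac{N-1}{N}\log p\Bigr)$$ (in particular, the left-hand side is real). Here $\omega_p=e^{2\pi i/p}$, $$\mu_j=\frac1{p^2}\sum_{x,y\in\mathbb Z_p}P(a-b=xy-j\mid x,y)=\frac1{p^2}\sum_{x,y,k\in\mathbb Z_p}P(a=k,\,b=k-xy+j\mid x,y)$$ with arithmetic modulo $p$, $h_p(x)=h(x)+(1-x)\log(p-1)$ with $h(x)=-x\log x-(1-x)\log(1-x)$, and $h_p^{-1}:[0,\log p]\to[1/p,1]$ is the inverse of the restriction of $h_p$ to $[1/p,1]$, on which $h_p$ is strictly decreasing. -/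

import Mathlib

/- With `ComplexOrder`, `z ≤ w` for complex `z`, `w` means `z.re ≤ w.re ∧ z.im = w.im`; so an
inequality between a complex number and a real one includes the claim that the former is real. -/
open scoped BigOperators ComplexOrder

noncomputable section

/-- A bipartite no-signalling box with input alphabets `X`, `Y` (Alice, Bob) and output alphabets
`A`, `B` (Alice, Bob): a conditional distribution `P(a, b | x, y)`, written `prob x y a b`,
both of whose marginals are independent of the input of the other party. -/
structure NSBox (X Y A B : Type) [Fintype A] [Fintype B] where
  prob : X → Y → A → B → ℝ
  nonneg : ∀ x y a b, 0 ≤ prob x y a b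
  sum_one : ∀ x y, ∑ a, ∑ b, prob x y a b = 1
  bob_cannot_signal : ∀ x y y' a, ∑ b, prob x y a b = ∑ b, prob x y' a b
  alice_cannot_signal : ∀ x x' y b, ∑ a, prob x y a b = ∑ a, prob x' y a b

/-- A `p`-nary-input, `p`-nary-output no-signalling box. -/
abbrev PBox (p : ℕ) [NeZero p] : Type := NSBox (ZMod p) (ZMod p) (ZMod p) (ZMod p)

/-- A no-signalling box together with its alphabets (the output alphabets are finite). -/
structure Resource where
  X : Type
  Y : Type
  A : Type
  B : Type
  fintypeA : Fintype A
  fintypeB : Fintype B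
  box : NSBox X Y A B

attribute [instance] Resource.fintypeA Resource.fintypeB

/-- A box, regarded as a resource. -/
def NSBox.toResource {X Y A B : Type} [iA : Fintype A] [iB : Fintype B] (P : NSBox X Y A B) :
    Resource :=
  ⟨X, Y, A, B, iA, iB, P⟩

/-- A (deterministic, adaptive) way in which one party uses its ends of `n` boxes one after the
other, each of them once. Given the outputs `o` of all the boxes, `order o k` is the box that is
used in step `k`, and `input o i` is what is fed into box `i`. By `causal`, the box used in step `k`
and its input depend only on the outputs obtained in the steps before `k`. (Not using a box amounts
to giving it a fixed input and ignoring its output, since all boxes are no-signalling.) -/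
structure Wiring {n : ℕ} (In Out : Fin n → Type) where
  order : (∀ i, Out i) → Equiv.Perm (Fin n)
  input : (∀ i, Out i) → ∀ i, In i
  causal : ∀ (o o' : ∀ i, Out i) (k : Fin n),
    (∀ l : Fin n, l < k → o (order o l) = o' (order o l)) →
      order o k = order o' k ∧ input o (order o k) = input o' (order o k)

/-- A protocol for the following task, in a world `W` (the set of boxes that are available there,
each in any number of independent copies): Alice holds `x ∈ (ZMod p)^N` and sends `m` digits from
`ZMod p` to Bob; Bob holds `y ∈ {0, …, N-1}` and has to guess `x y`.

* Alice and Bob share a random variable with values in the finite set `Λ` and distribution `ν`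
  (it also supplies all local randomness), and the boxes `box i ∈ W`, `i < n`.
* Alice uses her ends of the boxes as `alice` says, knowing `Λ` and `x`. Then she sends `message`,
  a function of all she knows.
* After that Bob uses his ends of the boxes as `bob` says, knowing `Λ`, the message and `y`.
  Then he outputs `guess`, a function of all he knows. -/
structure Protocol (p N m : ℕ) (W : Set Resource) where
  Λ : Type
  fintypeΛ : Fintype Λ
  ν : Λ → ℝ
  ν_nonneg : ∀ l, 0 ≤ ν l
  ν_sum : ∑ l, ν l = 1
  n : ℕ
  box : Fin n → Resource
  box_mem : ∀ i, box i ∈ W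
  alice : Λ → (Fin N → ZMod p) → Wiring (fun i => (box i).X) (fun i => (box i).A)
  message : Λ → (Fin N → ZMod p) → (∀ i, (box i).A) → (Fin m → ZMod p)
  bob : Λ → (Fin m → ZMod p) → Fin N → Wiring (fun i => (box i).Y) (fun i => (box i).B)
  guess : Λ → (Fin m → ZMod p) → Fin N → (∀ i, (box i).B) → ZMod p

attribute [instance] Protocol.fintypeΛ

namespace Protocol

variable {p N m : ℕ} {W : Set Resource}

/-- The probability that Bob outputs `g` when Alice's data are `x` and Bob's index is `y`: the sum,
over the values of the shared randomness and over all tuples `a`, `b` of outputs of the boxes on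
Alice's and on Bob's side for which the guess is `g`, of the probability of these values. -/
def guessProb (π : Protocol p N m W) (y : Fin N) (x : Fin N → ZMod p) (g : ZMod p) : ℝ :=
  ∑ l, π.ν l * ∑ a : ∀ i, (π.box i).A, ∑ b : ∀ i, (π.box i).B,
    if π.guess l (π.message l x a) y b = g then
      ∏ i, (π.box i).box.prob ((π.alice l x).input a i)
        ((π.bob l (π.message l x a) y).input b i) (a i) (b i)
    else 0

/-- The joint distribution of the digit `x i` and of Bob's output, given that Bob's index is `i`,
when `x` is uniformly distributed on `(ZMod p)^N`. -/
def digitGuessDist [NeZero p] (π : Protocol p N m W) (i : Fin N) (u g : ZMod p) : ℝ :=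
  1 / (p : ℝ) ^ N * ∑ x : Fin N → ZMod p, if x i = u then π.guessProb i x g else 0

end Protocol

/-- Mutual information `I(S : T) = H(S) + H(T) - H(S, T)` (in nats) of two random variables with
joint distribution `q` on a product of finite sets. -/
def mutualInfo {S T : Type} [Fintype S] [Fintype T] (q : S → T → ℝ) : ℝ :=
  ∑ s, Real.negMulLog (∑ t, q s t) + ∑ t, Real.negMulLog (∑ s, q s t)
    - ∑ s, ∑ t, Real.negMulLog (q s t)

/-- The figure of merit `I = ∑ i, I(x i : b | y = i)` of a protocol. -/
def Protocol.score {p N m : ℕ} [NeZero p] {W : Set Resource} (π : Protocol p N m W) : ℝ :=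
  ∑ i : Fin N, mutualInfo (π.digitGuessDist i)

/-- Information causality (for `p`-nary digits) in the world `W`: whatever the protocol, `m` digits
sent by Alice give Bob at most `m log p` of information about her data. -/
def InformationCausality (p : ℕ) [NeZero p] (W : Set Resource) : Prop :=
  ∀ (N m : ℕ) (π : Protocol p N m W), π.score ≤ m * Real.log p

/-- `μ_j = p⁻² ∑_{x,y} P(a - b = xy - j | x, y)`,
where `P(a - b = xy - j | x, y) = ∑_k P(a = k, b = k - xy + j | x, y)`. -/
def PBox.mu {p : ℕ} [NeZero p] (P : PBox p) (j : ZMod p) : ℝ :=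
  1 / (p : ℝ) ^ 2 * ∑ x : ZMod p, ∑ y : ZMod p, ∑ k : ZMod p, P.prob x y k (k - x * y + j)

/-- `h_p(x) = h(x) + (1 - x) log (p - 1)`, with `h` the binary entropy function. -/
def hp (p : ℕ) (x : ℝ) : ℝ := Real.binEntropy x + (1 - x) * Real.log ((p : ℝ) - 1)

/-- The inverse function of `h_p : [1/p, 1] → [0, log p]`; `h_p` is strictly decreasing on
`[1/p, 1]`. -/
def hpInv (p : ℕ) (v : ℝ) : ℝ := Function.invFunOn (hp p) (Set.Icc (1 / (p : ℝ)) 1) v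

/-- The root of unity `ω_p = exp (2πi/p)`. -/
def omega (p : ℕ) : ℂ := Complex.exp (2 * Real.pi * Complex.I / p)

/-- The function inverted by `hpInv` is indeed a bijection. -/
theorem hp_bijOn (p : ℕ) (h2 : 2 ≤ p) :
    Set.BijOn (hp p) (Set.Icc (1 / (p : ℝ)) 1) (Set.Icc 0 (Real.log p)) := by
  have hpos : (2 : ℝ) ≤ p := by exact_mod_cast h2
  have hp0 : (0 : ℝ) < p := by linarith
  have heq : ∀ x, hp p x = Real.qaryEntropy p (1 - x) := by
    intro x
    simp [hp, Real.qaryEntropy, Real.binEntropy_one_sub, add_comm]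
  have hone : 1 / (p : ℝ) ≤ 1 := by
    rw [div_le_one hp0]; linarith
  have hanti : StrictAntiOn (hp p) (Set.Icc (1 / (p : ℝ)) 1) := by
    intro x hx y hy hxy
    rw [heq, heq]
    apply Real.qaryEntropy_strictMonoOn h2
    · constructor <;> [linarith [hy.2]; linarith [hy.1]]
    · constructor <;> [linarith [hx.2]; linarith [hx.1]]
    · linarith
  have hcont : Continuous (hp p) := by
    have : hp p = fun x => Real.qaryEntropy p (1 - x) := funext heq
    rw [this]; fun_prop
  have h1 : hp p 1 = 0 := by simp [hp]
  have hlow : hp p (1 / (p : ℝ)) = Real.log p := by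
    have hq : (p : ℝ) - 1 ≠ 0 := by linarith
    have h' : 1 - (p : ℝ)⁻¹ = (p - 1) / p := by field_simp
    rw [hp, Real.binEntropy, one_div, h', inv_inv, inv_div, Real.log_div hp0.ne' hq]
    field_simp
    ring
  refine ⟨?_, hanti.injOn, ?_⟩
  · intro x hx
    have a1 := hanti.antitoneOn ⟨le_rfl, hone⟩ hx hx.1
    have a2 := hanti.antitoneOn hx ⟨hone, le_rfl⟩ hx.2
    rw [hlow] at a1
    rw [h1] at a2
    exact ⟨a2, a1⟩
  · have := intermediate_value_Icc' hone hcont.continuousOn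
    rwa [hlow, h1] at this

end

/-! Up to Fourier inversion, the left-hand side is the weight at `-c` of the `(N-1)`-fold
convolution of `P.mu`. This law is realised as the noise of one protocol. Alice interpolates her `N
≤ p` digits by a polynomial of degree below `N` over the field `ZMod p`, so that `x y` is its value
at `y`. Its constant term can be sent directly; each of the other `N - 1` terms is a product of an
Alice number and a Bob number, which one twirled box turns into a difference of outputs with error
law `P.mu` (`PBox.sum_twirl`). Alice's output corrections add up to a single digit, so `m = 1`
suffices. The error has the same law for every index and every `x` (`guessProb_randomAccess`), so
each index yields `log p` minus the entropy of that law. Information causality thus bounds the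
entropy below by `(N-1)/N * log p`, Fano's inequality (`sum_negMulLog_le_hp`) bounds it above by
`hp` of any single weight, and `le_hpInv` inverts `hp`. -/

/-! ### Convolution powers and their Fourier transform -/

/-- The law of the sum of `M` independent variables with law `w`. -/
def sumLaw {G : Type} [Fintype G] [DecidableEq G] [AddCommMonoid G] (M : ℕ) (w : G → ℝ) (t : G) :
    ℝ :=
  ∑ e : Fin M → G, if ∑ i, e i = t then ∏ i, w (e i) else 0

section SumLaw

variable {G : Type} [Fintype G] [DecidableEq G] [AddCommMonoid G] {M : ℕ} {w : G → ℝ}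

theorem sumLaw_nonneg (hw : ∀ t, 0 ≤ w t) (t : G) : 0 ≤ sumLaw M w t := by
  refine Finset.sum_nonneg fun e _ => ?_
  split_ifs
  · exact Finset.prod_nonneg fun i _ => hw _
  · exact le_rfl

theorem sum_sumLaw (hw : ∑ t, w t = 1) : ∑ t, sumLaw M w t = 1 := by
  unfold sumLaw
  rw [Finset.sum_comm]
  simp only [Finset.sum_ite_eq, Finset.mem_univ, if_true]
  have h := Finset.prod_univ_sum (fun _ : Fin M => (Finset.univ : Finset G)) (fun _ t => w t)
  rw [Fintype.piFinset_univ] at h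
  rw [← h, hw, Finset.prod_const_one]

/-- Three families of variables, indexed by `Fin M`, such that each of the `M` independent triples
yields a summand with law `w`. -/
theorem sum_ite_eq_sumLaw {L A B : Type} [Fintype L] [Fintype A] [Fintype B]
    (F : Fin M → L → A → B → ℝ) (E : Fin M → L → A → B → G)
    (h : ∀ i t, ∑ l, ∑ a, ∑ b, (if E i l a b = t then F i l a b else 0) = w t) (t : G) :
    ∑ l : Fin M → L, ∑ a : Fin M → A, ∑ b : Fin M → B,
      (if ∑ i, E i (l i) (a i) (b i) = t then ∏ i, F i (l i) (a i) (b i) else 0)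
      = sumLaw M w t := by
  have hprod : ∀ e : Fin M → G, ∏ i, w (e i) =
      ∑ l : Fin M → L, ∑ a : Fin M → A, ∑ b : Fin M → B,
        ∏ i, (if E i (l i) (a i) (b i) = e i then F i (l i) (a i) (b i) else 0) := by
    intro e
    rw [Finset.prod_congr rfl fun i _ => (h i (e i)).symm]
    simp only [Finset.prod_univ_sum, Fintype.piFinset_univ]
  have hpt : ∀ (l : Fin M → L) (a : Fin M → A) (b : Fin M → B),
      (∑ e : Fin M → G, if ∑ i, e i = t then
        ∏ i, (if E i (l i) (a i) (b i) = e i then F i (l i) (a i) (b i) else 0) else 0)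
      = if ∑ i, E i (l i) (a i) (b i) = t then ∏ i, F i (l i) (a i) (b i) else 0 := by
    intro l a b
    -- Only the tuple of actual errors makes every factor nonzero.
    rw [Finset.sum_eq_single (fun i => E i (l i) (a i) (b i))]
    · simp
    · intro e _ he
      obtain ⟨i, hi⟩ := Function.ne_iff.mp he
      rw [Finset.prod_eq_zero (Finset.mem_univ i) (if_neg (Ne.symm hi)), ite_self]
    · simp
  unfold sumLaw
  simp only [hprod, ← hpt]
  symm
  calc _ = ∑ e : Fin M → G, ∑ l : Fin M → L, ∑ a : Fin M → A, ∑ b : Fin M → B,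
        (if ∑ i, e i = t then
        ∏ i, (if E i (l i) (a i) (b i) = e i then F i (l i) (a i) (b i) else 0) else 0) := by
        refine Finset.sum_congr rfl fun e _ => ?_
        split_ifs <;> simp
    _ = _ := by
        rw [Finset.sum_comm]
        refine Finset.sum_congr rfl fun l _ => ?_
        rw [Finset.sum_comm]
        refine Finset.sum_congr rfl fun a _ => ?_
        rw [Finset.sum_comm]

end SumLaw

/-- Fourier inversion for the law of a sum of independent variables. -/
theorem sum_addChar_mul_pow_eq_sumLaw {p : ℕ} [NeZero p] (M : ℕ) (w : ZMod p → ℝ) (c : ZMod p) :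
    ∑ k : ZMod p, ZMod.stdAddChar (c * k) *
      (∑ j : ZMod p, (w j : ℂ) * ZMod.stdAddChar (j * k)) ^ M = p * sumLaw M w (-c) := by
  have hpow : ∀ k : ZMod p, (∑ j : ZMod p, (w j : ℂ) * ZMod.stdAddChar (j * k)) ^ M =
      ∑ e : Fin M → ZMod p, (∏ i, (w (e i) : ℂ)) * ZMod.stdAddChar ((∑ i, e i) * k) := by
    intro k
    have h := Finset.prod_univ_sum (fun _ : Fin M => (Finset.univ : Finset (ZMod p)))
      (fun _ j => (w j : ℂ) * ZMod.stdAddChar (j * k))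
    rw [Fintype.piFinset_univ, Finset.prod_const, Finset.card_univ, Fintype.card_fin] at h
    rw [h]
    refine Finset.sum_congr rfl fun e _ => ?_
    rw [Finset.prod_mul_distrib, Finset.sum_mul]
    congr 1
    exact (map_prod (ZMod.stdAddChar (N := p)).toMonoidHom
      (fun i => Multiplicative.ofAdd (e i * k)) Finset.univ).symm
  simp only [hpow, Finset.mul_sum]
  rw [Finset.sum_comm]
  unfold sumLaw
  rw [Complex.ofReal_sum, Finset.mul_sum]
  refine Finset.sum_congr rfl fun e _ => ?_
  -- Orthogonality of characters keeps exactly the tuples with sum `-c`.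
  have hsum := AddChar.sum_mulShift (R := ZMod p) (R' := ℂ) (c + ∑ i, e i)
    (ZMod.isPrimitive_stdAddChar p)
  have heq : (c + ∑ i, e i = 0) ↔ ∑ i, e i = -c := by
    rw [add_comm]; exact add_eq_zero_iff_eq_neg
  calc _ = (∏ i, (w (e i) : ℂ)) * ∑ k : ZMod p, ZMod.stdAddChar (k * (c + ∑ i, e i)) := by
        rw [Finset.mul_sum]
        refine Finset.sum_congr rfl fun k _ => ?_
        rw [mul_comm k, add_mul, AddChar.map_add_eq_mul]
        ring
    _ = _ := by
        rw [hsum]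
        simp only [heq, ZMod.card]
        split_ifs
        · push_cast; ring
        · simp

theorem omega_pow_val_mul_val {p : ℕ} [NeZero p] (a b : ZMod p) :
    omega p ^ (a.val * b.val) = ZMod.stdAddChar (a * b) := by
  have h : a * b = ((a.val * b.val : ℤ) : ZMod p) := by simp
  rw [h, ZMod.stdAddChar_coe, omega, ← Complex.exp_nat_mul]
  congr 1
  push_cast
  ring

/-! ### Fano's inequality and mutual information -/

section Entropy

/-- Fano's inequality, for the guess `c`. -/
theorem sum_negMulLog_le_hp {p : ℕ} (h2 : 2 ≤ p) {G : Type} [Fintype G]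
    (hcard : Fintype.card G = p) {q : G → ℝ} (h0 : ∀ t, 0 ≤ q t) (h1 : ∑ t, q t = 1) (c : G) :
    ∑ t, Real.negMulLog (q t) ≤ hp p (q c) := by
  classical
  have hp1 : (0 : ℝ) < (p : ℝ) - 1 := by
    have : (2 : ℝ) ≤ p := by exact_mod_cast h2
    linarith
  have hcard' : ((Finset.univ.erase c).card : ℝ) = (p : ℝ) - 1 := by
    rw [Finset.card_erase_of_mem (Finset.mem_univ c), Finset.card_univ, hcard,
      Nat.cast_sub (by omega), Nat.cast_one]
  have hrest : ∑ t ∈ Finset.univ.erase c, q t = 1 - q c := by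
    rw [← h1, ← Finset.add_sum_erase _ _ (Finset.mem_univ c)]; ring
  -- Jensen with equal weights on the `p - 1` values other than `c`.
  have hJ := Real.concaveOn_negMulLog.le_map_sum (t := Finset.univ.erase c)
    (w := fun _ => ((p : ℝ) - 1)⁻¹) (p := q) (fun _ _ => by positivity)
    (by rw [Finset.sum_const, nsmul_eq_mul, hcard', mul_inv_cancel₀ hp1.ne'])
    (fun t _ => h0 t)
  simp only [smul_eq_mul, ← Finset.mul_sum, hrest] at hJ
  rw [Real.negMulLog_mul, mul_comm, ← le_div_iff₀ (by positivity)] at hJ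
  rw [← Finset.add_sum_erase _ _ (Finset.mem_univ c), hp,
    Real.binEntropy_eq_negMulLog_add_negMulLog_one_sub]
  have hend : ((1 - q c) * Real.negMulLog ((p : ℝ) - 1)⁻¹ +
      ((p : ℝ) - 1)⁻¹ * Real.negMulLog (1 - q c)) / ((p : ℝ) - 1)⁻¹ =
      Real.negMulLog (1 - q c) + (1 - q c) * Real.log ((p : ℝ) - 1) := by
    rw [Real.negMulLog, Real.log_inv]
    field_simp
    ring
  rw [hend] at hJ
  linarith

theorem hp_strictAntiOn {p : ℕ} (h2 : 2 ≤ p) : StrictAntiOn (hp p) (Set.Icc (1 / (p : ℝ)) 1) := by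
  have heq : ∀ x, hp p x = Real.qaryEntropy p (1 - x) := by
    intro x
    simp [hp, Real.qaryEntropy, Real.binEntropy_one_sub, add_comm]
  intro x hx y hy hxy
  rw [heq, heq]
  apply Real.qaryEntropy_strictMonoOn h2
  · constructor <;> [linarith [hy.2]; linarith [hy.1]]
  · constructor <;> [linarith [hx.2]; linarith [hx.1]]
  · linarith

/-- No lower bound on `t` is needed: `hpInv` is at least `1/p`, so a `t` exceeding it lies in the
interval where `hp` is strictly decreasing. -/
theorem le_hpInv {p : ℕ} (h2 : 2 ≤ p) {v t : ℝ} (hv : v ∈ Set.Icc 0 (Real.log p)) (ht : t ≤ 1)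
    (h : v ≤ hp p t) : t ≤ hpInv p v := by
  have hmem : v ∈ hp p '' Set.Icc (1 / (p : ℝ)) 1 := (hp_bijOn p h2).surjOn hv
  have h1 : hpInv p v ∈ Set.Icc (1 / (p : ℝ)) 1 := Function.invFunOn_mem hmem
  have h3 : hp p (hpInv p v) = v := Function.invFunOn_eq hmem
  by_contra! hlt
  have := hp_strictAntiOn h2 h1 ⟨h1.1.trans hlt.le, ht⟩ hlt
  linarith

/-- The mutual information of a uniform variable and its translate by independent noise. -/
theorem mutualInfo_uniform_sub {p : ℕ} [NeZero p] {q : ZMod p → ℝ} (h1 : ∑ t, q t = 1) :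
    mutualInfo (fun u g : ZMod p => q (u - g) * (p : ℝ)⁻¹) =
      Real.log p - ∑ t, Real.negMulLog (q t) := by
  have hp0 : (p : ℝ) ≠ 0 := Nat.cast_ne_zero.mpr (NeZero.ne p)
  have hleft : ∀ (f : ZMod p → ℝ) (u : ZMod p), ∑ g, f (u - g) = ∑ t, f t :=
    fun f u => Fintype.sum_equiv (Equiv.subLeft u) _ _ fun _ => rfl
  have hright : ∀ (f : ZMod p → ℝ) (g : ZMod p), ∑ u, f (u - g) = ∑ t, f t :=
    fun f g => Fintype.sum_equiv (Equiv.subRight g) _ _ fun _ => rfl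
  have hu : ∀ u : ZMod p, ∑ g, q (u - g) * (p : ℝ)⁻¹ = (p : ℝ)⁻¹ := fun u => by
    rw [← Finset.sum_mul, hleft, h1, one_mul]
  have hg : ∀ g : ZMod p, ∑ u, q (u - g) * (p : ℝ)⁻¹ = (p : ℝ)⁻¹ := fun g => by
    rw [← Finset.sum_mul, hright, h1, one_mul]
  have hj : ∀ u : ZMod p, ∑ g, Real.negMulLog (q (u - g) * (p : ℝ)⁻¹) =
      (p : ℝ)⁻¹ * ∑ t, Real.negMulLog (q t) + Real.negMulLog (p : ℝ)⁻¹ := fun u => by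
    rw [hleft (fun t => Real.negMulLog (q t * (p : ℝ)⁻¹))]
    simp only [Real.negMulLog_mul, Finset.sum_add_distrib, ← Finset.mul_sum, ← Finset.sum_mul, h1,
      one_mul]
  unfold mutualInfo
  have hlog : Real.negMulLog (p : ℝ)⁻¹ = (p : ℝ)⁻¹ * Real.log p := by
    rw [Real.negMulLog, Real.log_inv]; ring
  simp only [hu, hg, hj, hlog, Finset.sum_const, Finset.card_univ, ZMod.card, nsmul_eq_mul]
  field_simp
  ring

end Entropy

/-! ### The error law of a twirled box -/

section Box

variable {p : ℕ} [NeZero p] (P : PBox p)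

theorem PBox.mu_nonneg (j : ZMod p) : 0 ≤ P.mu j := by
  unfold PBox.mu
  have : 0 ≤ ∑ x : ZMod p, ∑ y : ZMod p, ∑ k : ZMod p, P.prob x y k (k - x * y + j) :=
    Finset.sum_nonneg fun _ _ => Finset.sum_nonneg fun _ _ => Finset.sum_nonneg fun _ _ =>
      P.nonneg _ _ _ _
  positivity

theorem PBox.sum_mu : ∑ j, P.mu j = 1 := by
  have hp0 : (p : ℝ) ≠ 0 := Nat.cast_ne_zero.mpr (NeZero.ne p)
  unfold PBox.mu
  rw [← Finset.mul_sum, Finset.sum_comm]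
  have h : ∀ x y : ZMod p, ∑ j : ZMod p, ∑ k : ZMod p, P.prob x y k (k - x * y + j) = 1 := by
    intro x y
    rw [Finset.sum_comm, ← P.sum_one x y]
    exact Finset.sum_congr rfl fun k _ =>
      Fintype.sum_equiv (Equiv.addLeft (k - x * y)) _ _ fun _ => rfl
  have h' : ∀ x : ZMod p, ∑ j : ZMod p, ∑ y : ZMod p, ∑ k : ZMod p,
      P.prob x y k (k - x * y + j) = p := by
    intro x
    rw [Finset.sum_comm]
    simp [h]
  simp only [h', Finset.sum_const, Finset.card_univ, ZMod.card, nsmul_eq_mul]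
  field_simp

/-- Shifting the inputs by shared uniform `r.1`, `r.2` and correcting the outputs makes the error
of the box have law `mu` for each pair of inputs. -/
theorem PBox.sum_twirl (u v t : ZMod p) :
    ∑ r : ZMod p × ZMod p, ∑ a : ZMod p, ∑ b : ZMod p,
      (if u * v - ((a - (u + r.1) * r.2) - (b + r.1 * v)) = t then
        1 / (p : ℝ) ^ 2 * P.prob (u + r.1) (v + r.2) a b else 0) = P.mu t := by
  unfold PBox.mu
  rw [Fintype.sum_prod_type, Finset.mul_sum]
  refine Fintype.sum_equiv (Equiv.addLeft u) _ _ fun r => ?_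
  rw [Finset.mul_sum]
  refine Fintype.sum_equiv (Equiv.addLeft v) _ _ fun s => ?_
  rw [Finset.mul_sum]
  refine Finset.sum_congr rfl fun a _ => ?_
  -- The corrections complete `u * v` to `(u + r) * (v + s)`, so an error `t` determines `b` from
  -- `a`.
  rw [Finset.sum_eq_single (a - (u + r) * (v + s) + t)]
  · rw [if_pos (by ring)]
    rfl
  · intro b _ hb
    refine if_neg fun h => hb ?_
    rw [← h]; ring
  · simp

end Box

/-- The wiring that feeds fixed inputs into all boxes. -/
def Wiring.parallel {n : ℕ} {In Out : Fin n → Type} (inp : ∀ i, In i) : Wiring In Out where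
  order _ := 1
  input _ := inp
  causal _ _ _ _ := ⟨rfl, rfl⟩

/-! ### Interpolation of Alice's digits -/

section Interpolation

variable {p : ℕ} [Fact p.Prime]

/-- The coefficients of the polynomial over `ZMod p` with values `x i` at `i`, `i < N`. -/
noncomputable def interpCoeff {N : ℕ} (x : Fin N → ZMod p) (k : ℕ) : ZMod p :=
  (Lagrange.interpolate Finset.univ (fun i : Fin N => ((i : ℕ) : ZMod p)) x).coeff k

theorem sum_interpCoeff {M : ℕ} (hM : M + 1 ≤ p) (x : Fin (M + 1) → ZMod p) (y : Fin (M + 1)) :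
    interpCoeff x 0 + ∑ i : Fin M, interpCoeff x (i + 1) * ((y : ℕ) : ZMod p) ^ ((i : ℕ) + 1)
      = x y := by
  -- The hypothesis `M + 1 ≤ p` keeps the nodes distinct modulo `p`.
  have hinj : Function.Injective (fun i : Fin (M + 1) => ((i : ℕ) : ZMod p)) := by
    intro i j h
    have h' := (ZMod.natCast_eq_natCast_iff' _ _ _).mp h
    rw [Nat.mod_eq_of_lt (by omega), Nat.mod_eq_of_lt (by omega)] at h'
    exact Fin.ext h'
  set f := Lagrange.interpolate Finset.univ (fun i : Fin (M + 1) => ((i : ℕ) : ZMod p)) x with hf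
  have hdeg : f.degree < (M + 1 : ℕ) := by
    have h := Lagrange.degree_interpolate_lt (s := Finset.univ) x hinj.injOn
    rwa [Finset.card_univ, Fintype.card_fin] at h
  have hnat : f.natDegree < M + 1 := by
    by_cases h0 : f = 0
    · simp [h0]
    · exact (Polynomial.natDegree_lt_iff_degree_lt h0).mpr hdeg
  have hev : f.eval ((y : ℕ) : ZMod p) = x y :=
    Lagrange.eval_interpolate_at_node (s := Finset.univ) x hinj.injOn (Finset.mem_univ y)
  rw [← hev, Polynomial.eval_eq_sum_range' hnat, Finset.sum_range, Fin.sum_univ_succ]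
  simp [interpCoeff, hf]

end Interpolation

/-! ### The random access protocol and its score -/

section RandomAccess

variable {p : ℕ} [Fact p.Prime]

/-- Alice's message: the constant term plus her corrected box outputs. -/
noncomputable def randomAccessMessage {M : ℕ} (l : Fin M → ZMod p × ZMod p)
    (x : Fin (M + 1) → ZMod p) (a : Fin M → ZMod p) : ZMod p :=
  interpCoeff x 0 + ∑ i : Fin M, (a i - (interpCoeff x (i + 1) + (l i).1) * (l i).2)

/-- Bob's guess: the message minus his corrected box outputs. -/
def randomAccessGuess {M : ℕ} (l : Fin M → ZMod p × ZMod p) (s : ZMod p) (y : Fin (M + 1))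
    (b : Fin M → ZMod p) : ZMod p :=
  s - ∑ i : Fin M, (b i + (l i).1 * ((y : ℕ) : ZMod p) ^ ((i : ℕ) + 1))

/-- Random access to `M + 1` digits with `M` copies of a box: the `i`-th copy, twirled by `l i`,
evaluates the term of degree `i + 1` of the interpolation polynomial of Alice's digits. -/
noncomputable def randomAccess (W : Set Resource) (P : PBox p) (hP : P.toResource ∈ W) (M : ℕ) :
    Protocol p (M + 1) 1 W where
  Λ := Fin M → ZMod p × ZMod p
  fintypeΛ := inferInstance
  -- The product form lets each factor merge with the probability of the matching copy.
  ν _ := ∏ _i : Fin M, 1 / (p : ℝ) ^ 2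
  ν_nonneg _ := by positivity
  ν_sum := by
    have hp0 : (p : ℝ) ≠ 0 := Nat.cast_ne_zero.mpr (NeZero.ne p)
    simp [ZMod.card]
    field_simp
  n := M
  box _ := P.toResource
  box_mem _ := hP
  alice l x := Wiring.parallel fun i => (interpCoeff x (i + 1) + (l i).1 : ZMod p)
  message l x a _ := randomAccessMessage l x a
  bob l _ y := Wiring.parallel fun i => (((y : ℕ) : ZMod p) ^ ((i : ℕ) + 1) + (l i).2 : ZMod p)
  guess l s y b := randomAccessGuess l (s 0) y b

variable (W : Set Resource) (P : PBox p) (hP : P.toResource ∈ W) {M : ℕ}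

/-- The constant term cancels, and `x y - g` is the sum of the independent errors of the `M` copies.
-/
theorem guessProb_randomAccess (hM : M + 1 ≤ p) (y : Fin (M + 1)) (x : Fin (M + 1) → ZMod p)
    (g : ZMod p) :
    (randomAccess W P hP M).guessProb y x g = sumLaw M P.mu (x y - g) := by
  rw [← sum_ite_eq_sumLaw (M := M) (w := P.mu) (L := ZMod p × ZMod p) (A := ZMod p) (B := ZMod p)
    (fun i r a b => 1 / (p : ℝ) ^ 2 * P.prob (interpCoeff x (i + 1) + r.1)
      (((y : ℕ) : ZMod p) ^ ((i : ℕ) + 1) + r.2) a b)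
    (fun i r a b => interpCoeff x (i + 1) * ((y : ℕ) : ZMod p) ^ ((i : ℕ) + 1) -
      ((a - (interpCoeff x (i + 1) + r.1) * r.2) - (b + r.1 * ((y : ℕ) : ZMod p) ^ ((i : ℕ) + 1))))
    (fun i t => P.sum_twirl _ _ t) (x y - g)]
  show ∑ l : Fin M → ZMod p × ZMod p, (∏ _i : Fin M, 1 / (p : ℝ) ^ 2) *
    ∑ a : Fin M → ZMod p, ∑ b : Fin M → ZMod p,
      (if randomAccessGuess l (randomAccessMessage l x a) y b = g then
        ∏ i : Fin M, P.prob (interpCoeff x (i + 1) + (l i).1)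
          (((y : ℕ) : ZMod p) ^ ((i : ℕ) + 1) + (l i).2) (a i) (b i) else 0) = _
  refine Finset.sum_congr rfl fun l _ => ?_
  rw [Finset.mul_sum]
  refine Finset.sum_congr rfl fun a _ => ?_
  rw [Finset.mul_sum]
  refine Finset.sum_congr rfl fun b _ => ?_
  rw [mul_ite, mul_zero, ← Finset.prod_mul_distrib]
  refine if_congr ?_ rfl rfl
  rw [randomAccessGuess, randomAccessMessage, ← sum_interpCoeff hM x y]
  simp only [Finset.sum_sub_distrib]
  constructor <;> intro h <;> linear_combination -h

theorem digitGuessDist_randomAccess (hM : M + 1 ≤ p) (i : Fin (M + 1)) (u g : ZMod p) :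
    (randomAccess W P hP M).digitGuessDist i u g = sumLaw M P.mu (u - g) * (p : ℝ)⁻¹ := by
  have hp0 : (p : ℝ) ≠ 0 := Nat.cast_ne_zero.mpr (NeZero.ne p)
  have hcount : ∑ x : Fin (M + 1) → ZMod p, (if x i = u then (1 : ℝ) else 0) = (p : ℝ) ^ M := by
    -- Splitting off coordinate `i` leaves `M` free digits.
    rw [← (Fin.insertNthEquiv (fun _ => ZMod p) i).sum_comp, Fintype.sum_prod_type]
    simp [ZMod.card]
  unfold Protocol.digitGuessDist
  calc _ = 1 / (p : ℝ) ^ (M + 1) * ∑ x : Fin (M + 1) → ZMod p,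
        (if x i = u then (1 : ℝ) else 0) * sumLaw M P.mu (u - g) := by
        congr 1
        refine Finset.sum_congr rfl fun x _ => ?_
        rw [guessProb_randomAccess W P hP hM]
        split_ifs with h <;> simp [h]
    _ = _ := by
        rw [← Finset.sum_mul, hcount]
        field_simp
        ring

theorem score_randomAccess (hM : M + 1 ≤ p) :
    (randomAccess W P hP M).score =
      (M + 1) * (Real.log p - ∑ t, Real.negMulLog (sumLaw M P.mu t)) := by
  have h : ∀ i, (randomAccess W P hP M).digitGuessDist i =
      fun u g => sumLaw M P.mu (u - g) * (p : ℝ)⁻¹ := fun i =>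
    funext₂ (digitGuessDist_randomAccess W P hP hM i)
  simp only [Protocol.score, h, mutualInfo_uniform_sub (sum_sumLaw P.sum_mu), Finset.sum_const,
    Finset.card_univ, Fintype.card_fin, nsmul_eq_mul]
  push_cast
  rfl

end RandomAccess

/-! ### The bound from information causality -/

theorem theorem2 (p : ℕ) [Fact p.Prime] (W : Set Resource) (hIC : InformationCausality p W)
    (P : PBox p) (hP : P.toResource ∈ W) (N : ℕ) (hN1 : 1 ≤ N) (hNp : N ≤ p) (c : ZMod p) :
    1 / (p : ℂ) * ∑ k : ZMod p, omega p ^ (c.val * k.val) *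
        (∑ j : ZMod p, (P.mu j : ℂ) * omega p ^ (j.val * k.val)) ^ (N - 1)
      ≤ ((hpInv p (((N : ℝ) - 1) / N * Real.log p) : ℝ) : ℂ) := by
  obtain ⟨M, rfl⟩ : ∃ M, N = M + 1 := ⟨N - 1, by omega⟩
  have h2 : 2 ≤ p := (Fact.out : p.Prime).two_le
  have hpC : (p : ℂ) ≠ 0 := Nat.cast_ne_zero.mpr (NeZero.ne p)
  have hlog : 0 ≤ Real.log p := Real.log_natCast_nonneg p
  have hM0 : (0 : ℝ) < (M : ℝ) + 1 := by positivity
  simp only [omega_pow_val_mul_val, Nat.add_sub_cancel]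
  rw [sum_addChar_mul_pow_eq_sumLaw, ← mul_assoc, one_div_mul_cancel hpC, one_mul,
    Complex.real_le_real]
  have h0 := sumLaw_nonneg (M := M) P.mu_nonneg
  have h1 : ∑ t, sumLaw M P.mu t = 1 := sum_sumLaw P.sum_mu
  have hscore := hIC (M + 1) 1 (randomAccess W P hP M)
  rw [score_randomAccess W P hP hNp, Nat.cast_one, one_mul] at hscore
  have hN : ((M + 1 : ℕ) : ℝ) - 1 = M := by push_cast; ring
  rw [hN, Nat.cast_add, Nat.cast_one]
  refine le_hpInv h2 ⟨by positivity, ?_⟩ ?_ (le_trans ?_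
    (sum_negMulLog_le_hp h2 (ZMod.card p) h0 h1 (-c)))
  · exact mul_le_of_le_one_left hlog ((div_le_one hM0).mpr (by linarith))
  · rw [← h1]
    exact Finset.single_le_sum (fun t _ => h0 t) (Finset.mem_univ (-c))
  -- With `H` the entropy of the error law, `(M + 1) * (log p - H) ≤ log p` rearranges to `M * log p
  -- ≤ H * (M + 1)`.
  · rw [div_mul_eq_mul_div, div_le_iff₀ hM0]
    linarith
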